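/- Let $(X,\mathcal B)$ be a measurable space with countably generated $\sigma$-algebra, let $m=(m_x)_{x\in X}$ be a family of probability measures on $\mathcal B$ such that $x\mapsto m_x(B)$ is measurable for every $B\in\mathcal B$, and let $\nu$ be a $\sigma$-finite measure on $X$ that is reversible for $m$, i.e. $dm_x(y)\,d\nu(x)=dm_y(x)\,d\nu(y)$. For $\Omega\in\mathcal B$ put $\partial_m\Omega=\{x\in X\setminus\Omega: m_x(\Omega)>0\}$ and $\Omega_m=\Omega\cup\partial_m\Omega$. Assume that (a) $0<\nu(\Omega)<\nu(\Omega_m)<\infty$; (b) $\Omega$ is $m$-connected: $\int_A m_x(B)\,d\nu(x)>0$ for all measurable non-$\nu$-null sets $A,B\subset\Omega$ with $A\cup B=\Omega$; (c) $\Omega$ satisfies a $2$-Poincaré inequality: there is $\lambda>0$ such that $\lambda\int_\Omega f^2\,d\nu\le\int_{\Omega_m}\int_{\Omega_m}(f(y)-f(x))^2\,dm_x(y)\,d\nu(x)$ for all $f\in L^2(\Omega_m,\nu)$ with $f=0$ $\nu$-a.e. on $\partial_m\Omega$. Let $g_{m,\Omega}(0)=\nu(\Omega)$ and, for $n\ge1$,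 $$g_{m,\Omega}(n)=\int_{\Omega}\int_\Omega\cdots\int_{\Omega}dm_{x_n}(x_{n+1})\cdots dm_{x_1}(x_2)\,d\nu(x_1).$$ Then the homogeneous Dirichlet problem for the $m$-heat equation, $$\frac{dv}{dt}(t,x)=\int_{\Omega_m}(v(t,y)-v(t,x))\,dm_x(y)\ \ (t>0,\ x\in\Omega),\qquad v(t,x)=0\ \ (t>0,\ x\in\partial_m\Omega),\qquad v(0,x)=1\ \ (x\in\Omega),$$ has a unique strong solution $v$ with values in $L^2(\Omega_m,\nu)$ (that is, $t\mapsto v(t,\cdot)\in L^2(\Omega_m,\nu)$ is continuous on $[0,\infty)$ and differentiable on $(0,\infty)$, and the three equations hold for $\nu$-a.e. $x$). Let $\mathbb Q^m_\Omega(t)=\int_\Omega v(t,x)\,d\nu(x)$ be the spectral $m$-heat content of $\Omega$. For every integer $j\ge1$ the integral defining the exit-$m$-moment $$EM^m_j(\Omega)=j\int_0^\infty t^{j-1}\,\mathbb Q^m_\Omega(t)\,dt$$ and the series below converge absolutely, and $$EM^m_j(\Omega)=j!\,\sum_{k=0}^{\infty}\binom{k+j-1}{j-1}\,g_{m,\Omega}(k).$$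 -/

import Mathlib

open MeasureTheory ProbabilityTheory Set

namespace RandomWalk

section Sets

variable {X : Type*} [MeasurableSpace X]

/-- The `m`-boundary `∂_m Ω` of `Ω`. -/
def mBoundary (m : Kernel X X) (Ω : Set X) : Set X :=
  {x | x ∉ Ω ∧ 0 < m x Ω}

/-- The `m`-closure `Ω_m = Ω ∪ ∂_m Ω` of `Ω`. -/
def mClosure (m : Kernel X X) (Ω : Set X) : Set X :=
  Ω ∪ mBoundary m Ω

/-- The `m`-interaction `L_m(A, B) = ∫_A m_x(B) dν(x)`. -/
noncomputable def interaction (m : Kernel X X) (ν : Measure X) (A B : Set X) : ENNReal :=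
  ∫⁻ x in A, m x B ∂ν

/-- `Ω` is `m`-connected with respect to `ν`. -/
def IsMConnected (m : Kernel X X) (ν : Measure X) (Ω : Set X) : Prop :=
  ∀ A B : Set X, MeasurableSet A → MeasurableSet B → A ∪ B = Ω → ν A ≠ 0 → ν B ≠ 0 →
    0 < interaction m ν A B

/-- `Ω` satisfies a 2-Poincaré inequality: the inequality is required of all
`f ∈ L²(Ω_m, ν)` that vanish a.e. on the `m`-boundary. -/
def SatisfiesTwoPoincare (m : Kernel X X) (ν : Measure X) (Ω : Set X) : Prop :=
  ∃ c : ℝ, 0 < c ∧ ∀ f : X → ℝ, MemLp f 2 (ν.restrict (mClosure m Ω)) →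
    (∀ᵐ x ∂ν.restrict (mBoundary m Ω), f x = 0) →
    c * ∫ x in Ω, f x ^ 2 ∂ν ≤
      ∫ z in mClosure m Ω ×ˢ mClosure m Ω, (f z.2 - f z.1) ^ 2 ∂(ν ⊗ₘ m)

end Sets

section Jumps

variable {X : Type*} [MeasurableSpace X]

/-- The iterated integral `∫_Ω ⋯ ∫_Ω dm_{x_n}(x_{n+1}) ⋯ dm_{x_1}(x_2)` as a function of the
starting point `x_1 = x`: the probability that the first `n` jumps from `x` all land in `Ω`. -/
noncomputable def stayProb (m : Kernel X X) (Ω : Set X) : ℕ → X → ENNReal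
  | 0, _ => 1
  | n + 1, x => ∫⁻ y in Ω, stayProb m Ω n y ∂(m x)

/-- `g_{m,Ω}(n)`: the `ν`-measure of the individuals that start in `Ω` and are in `Ω` after `n`
jumps without ever having left `Ω`. -/
noncomputable def g (m : Kernel X X) (ν : Measure X) (Ω : Set X) (n : ℕ) : ℝ :=
  (∫⁻ x in Ω, stayProb m Ω n x ∂ν).toReal

end Jumps

section Heat

variable {X : Type*} [MeasurableSpace X]

/-- `v` is a (strong) solution, with values in `L²(Ω_m, ν)`, of the homogeneous Dirichlet problem
for the `m`-heat equation on `Ω` with initial datum `1` on `Ω`. Only the values `v t` with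
`0 ≤ t` are meaningful. -/
structure IsDirichletHeatSolution (m : Kernel X X) (ν : Measure X) (Ω : Set X)
    (v : ℝ → Lp ℝ 2 (ν.restrict (mClosure m Ω))) : Prop where
  continuousOn : ContinuousOn v (Ici 0)
  differentiableAt : ∀ t : ℝ, 0 < t → DifferentiableAt ℝ v t
  equation : ∀ t : ℝ, 0 < t → ∀ᵐ x ∂ν.restrict Ω,
    (deriv v t : Lp ℝ 2 (ν.restrict (mClosure m Ω))) x =
      ∫ y in mClosure m Ω, (v t y - v t x) ∂(m x)
  boundary : ∀ t : ℝ, 0 < t → ∀ᵐ x ∂ν.restrict (mBoundary m Ω), v t x = 0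
  initial : ∀ᵐ x ∂ν.restrict Ω, v 0 x = 1

/-- The spectral `m`-heat content `Q(t) = ∫_Ω v(t, x) dν(x)` that belongs to `v`. -/
noncomputable def heatContent (m : Kernel X X) (ν : Measure X) (Ω : Set X)
    (v : ℝ → Lp ℝ 2 (ν.restrict (mClosure m Ω))) (t : ℝ) : ℝ :=
  ∫ x in Ω, v t x ∂ν

/-- The `j`-th exit moment `j ∫_0^∞ t^{j-1} Q(t) dt` (for `1 ≤ j`) of a heat content `Q`. -/
noncomputable def exitMoment (Q : ℝ → ℝ) (j : ℕ) : ℝ :=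
  j * ∫ t in Ioi (0 : ℝ), t ^ (j - 1) * Q t

end Heat

end RandomWalk

namespace RandomWalk

section Basic

variable {X : Type*} [MeasurableSpace X] {m : Kernel X X} {ν : Measure X} {Ω : Set X}

theorem measurableSet_mBoundary (m : Kernel X X) (hΩ : MeasurableSet Ω) :
    MeasurableSet (mBoundary m Ω) :=
  hΩ.compl.inter (measurableSet_lt measurable_const (m.measurable_coe hΩ))

theorem measurableSet_mClosure (m : Kernel X X) (hΩ : MeasurableSet Ω) :
    MeasurableSet (mClosure m Ω) :=
  hΩ.union (measurableSet_mBoundary m hΩ)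

theorem subset_mClosure : Ω ⊆ mClosure m Ω := subset_union_left

theorem mBoundary_subset_mClosure : mBoundary m Ω ⊆ mClosure m Ω := subset_union_right

theorem restrict_restrict_mClosure (hΩ : MeasurableSet Ω) :
    (ν.restrict (mClosure m Ω)).restrict Ω = ν.restrict Ω := by
  rw [Measure.restrict_restrict hΩ, inter_eq_left.2 subset_mClosure]

/-- Almost every jump that starts in `Ω` lands in the `m`-closure of `Ω`. -/
theorem ae_measure_mClosure_eq_one [IsMarkovKernel m] (hrev : m.IsReversible ν)
    (hΩ : MeasurableSet Ω) : ∀ᵐ x ∂ν.restrict Ω, m x (mClosure m Ω) = 1 := by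
  have hC := measurableSet_mClosure m hΩ
  have h0 : ∫⁻ x in Ω, m x (mClosure m Ω)ᶜ ∂ν = 0 := by
    rw [hrev hΩ hC.compl, setLIntegral_congr_fun hC.compl (g := fun _ => 0)]
    · simp
    · intro x hx
      by_contra hne
      exact hx (or_iff_not_imp_left.2 fun h => ⟨h, pos_iff_ne_zero.2 hne⟩)
  rw [lintegral_eq_zero_iff (m.measurable_coe hC.compl)] at h0
  filter_upwards [h0] with x hx
  exact (prob_compl_eq_zero_iff hC).1 hx

theorem lintegral_lintegral_of_isReversible [IsMarkovKernel m] (hrev : m.IsReversible ν)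
    {f : X → ENNReal} (hf : Measurable f) : ∫⁻ x, ∫⁻ y, f y ∂m x ∂ν = ∫⁻ x, f x ∂ν := by
  rw [← Measure.lintegral_bind m.aemeasurable hf.aemeasurable, hrev.invariant.def]

theorem ae_ae_of_isReversible [IsMarkovKernel m] (hrev : m.IsReversible ν) {p : X → Prop}
    (hp : ∀ᵐ x ∂ν, p x) : ∀ᵐ x ∂ν, ∀ᵐ y ∂m x, p y := by
  rw [← hrev.invariant.def] at hp
  exact Measure.ae_ae_of_ae_comp hp

/-- Detailed balance, tested against products of functions. -/
theorem lintegral_mul_lintegral_comm [IsMarkovKernel m] (hrev : m.IsReversible ν)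
    {f h : X → ENNReal} (hf : Measurable f) (hh : Measurable h) :
    ∫⁻ x, f x * ∫⁻ y, h y ∂m x ∂ν = ∫⁻ x, h x * ∫⁻ y, f y ∂m x ∂ν := by
  have hind : ∀ {A : Set X}, MeasurableSet A → ∀ {h : X → ENNReal}, Measurable h →
      ∫⁻ x in A, ∫⁻ y, h y ∂m x ∂ν = ∫⁻ x, h x * m x A ∂ν := by
    intro A hA h hh
    have hmA := m.measurable_coe hA
    refine hh.ennreal_induction ?_ ?_ ?_
    · intro c s hs
      have h1 : ∀ x, s.indicator (fun _ => c) x * m x A = s.indicator (fun x => c * m x A) x := by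
        intro x; by_cases hx : x ∈ s <;> simp [hx]
      simp_rw [h1, lintegral_indicator hs, setLIntegral_const]
      rw [lintegral_const_mul _ (m.measurable_coe hs), lintegral_const_mul _ hmA, hrev hA hs]
    · intro f g _ hf hg h1 h2
      simp only [Pi.add_apply, add_mul]
      simp_rw [lintegral_add_left hf]
      rw [lintegral_add_left hf.lintegral_kernel, lintegral_add_left (by fun_prop), h1, h2]
    · intro f hf hmono h1
      simp_rw [lintegral_iSup hf hmono, ENNReal.iSup_mul]
      rw [lintegral_iSup (fun n => (hf n).lintegral_kernel), lintegral_iSup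
        (f := fun n x => f n x * m x A) (fun n => (hf n).mul hmA)]
      · simp_rw [h1]
      · intro i j hij x; exact mul_le_mul_left (hmono hij x) _
      · intro i j hij x; exact lintegral_mono (hmono hij)
  have hh' : Measurable fun x => ∫⁻ y, h y ∂m x := hh.lintegral_kernel
  refine hf.ennreal_induction ?_ ?_ ?_
  · intro c s hs
    have hms := m.measurable_coe hs
    have h1 : ∀ x, s.indicator (fun _ => c) x * ∫⁻ y, h y ∂m x
        = s.indicator (fun x => c * ∫⁻ y, h y ∂m x) x := by
      intro x; by_cases hx : x ∈ s <;> simp [hx]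
    simp_rw [h1, lintegral_indicator hs, setLIntegral_const, mul_left_comm]
    rw [lintegral_const_mul _ hh', hind hs hh, lintegral_const_mul _ (by fun_prop)]
  · intro f g _ hf hg h1 h2
    have hf' : Measurable fun x => ∫⁻ y, f y ∂m x := hf.lintegral_kernel
    simp only [Pi.add_apply, add_mul]
    simp_rw [lintegral_add_left hf, mul_add]
    rw [lintegral_add_left (by fun_prop), lintegral_add_left (by fun_prop), h1, h2]
  · intro f hf hmono h1
    simp_rw [lintegral_iSup hf hmono, ENNReal.iSup_mul, ENNReal.mul_iSup]
    rw [lintegral_iSup (f := fun n x => f n x * ∫⁻ y, h y ∂m x) (fun n => (hf n).mul hh'),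
      lintegral_iSup (f := fun n x => h x * ∫⁻ y, f n y ∂m x)
        (fun n => hh.mul (hf n).lintegral_kernel)]
    · simp_rw [h1]
    · intro i j hij x; exact mul_le_mul_right (lintegral_mono (hmono hij)) _
    · intro i j hij x; exact mul_le_mul_left (hmono hij x) _

end Basic

section StayProb

variable {X : Type*} [MeasurableSpace X] {m : Kernel X X} {ν : Measure X} {Ω : Set X}

theorem measurable_stayProb (hΩ : MeasurableSet Ω) (n : ℕ) : Measurable (stayProb m Ω n) := by
  induction n with
  | zero => exact measurable_const
  | succ n ih =>
    have : stayProb m Ω (n + 1) = fun x => ∫⁻ y, Ω.indicator (stayProb m Ω n) y ∂m x := by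
      ext x; simp [stayProb, lintegral_indicator hΩ]
    rw [this]
    exact (ih.indicator hΩ).lintegral_kernel

theorem stayProb_succ_le [IsMarkovKernel m] (n : ℕ) (x : X) :
    stayProb m Ω (n + 1) x ≤ stayProb m Ω n x := by
  induction n generalizing x with
  | zero => simpa [stayProb] using prob_le_one
  | succ n ih => exact lintegral_mono ih

theorem stayProb_le_one [IsMarkovKernel m] (n : ℕ) (x : X) : stayProb m Ω n x ≤ 1 := by
  induction n with
  | zero => exact le_rfl
  | succ n ih => exact (stayProb_succ_le n x).trans ih

theorem stayProb_ne_top [IsMarkovKernel m] (n : ℕ) (x : X) : stayProb m Ω n x ≠ ⊤ :=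
  ((stayProb_le_one n x).trans_lt ENNReal.one_lt_top).ne

theorem lintegral_stayProb_mul_succ [IsMarkovKernel m] (hrev : m.IsReversible ν)
    (hΩ : MeasurableSet Ω) (a b : ℕ) :
    ∫⁻ x in Ω, stayProb m Ω a x * stayProb m Ω (b + 1) x ∂ν =
      ∫⁻ x in Ω, stayProb m Ω (a + 1) x * stayProb m Ω b x ∂ν := by
  have e : ∀ u w : X → ENNReal, ∫⁻ x, Ω.indicator u x * ∫⁻ y, Ω.indicator w y ∂m x ∂ν =
      ∫⁻ x in Ω, u x * ∫⁻ y in Ω, w y ∂m x ∂ν := by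
    intro u w
    rw [← lintegral_indicator hΩ]
    refine lintegral_congr fun x => ?_
    by_cases hx : x ∈ Ω <;> simp [hx, lintegral_indicator hΩ]
  have h := lintegral_mul_lintegral_comm hrev ((measurable_stayProb (m := m) hΩ a).indicator hΩ)
    ((measurable_stayProb (m := m) hΩ b).indicator hΩ)
  rw [e, e] at h
  simpa only [stayProb, mul_comm] using h

theorem lintegral_stayProb_mul [IsMarkovKernel m] (hrev : m.IsReversible ν)
    (hΩ : MeasurableSet Ω) (a b : ℕ) :
    ∫⁻ x in Ω, stayProb m Ω a x * stayProb m Ω b x ∂ν =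
      ∫⁻ x in Ω, stayProb m Ω (a + b) x ∂ν := by
  induction b generalizing a with
  | zero => simp [stayProb]
  | succ b ih => rw [lintegral_stayProb_mul_succ hrev hΩ, ih, Nat.add_right_comm, add_assoc]

theorem lintegral_stayProb_ne_top [IsMarkovKernel m] (hfin : ν Ω ≠ ⊤) (n : ℕ) :
    ∫⁻ x in Ω, stayProb m Ω n x ∂ν ≠ ⊤ := by
  refine ((lintegral_mono (stayProb_le_one n)).trans_lt ?_).ne
  simpa using hfin.lt_top

theorem g_nonneg (n : ℕ) : 0 ≤ g m ν Ω n := ENNReal.toReal_nonneg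

theorem g_succ_le [IsMarkovKernel m] (hfin : ν Ω ≠ ⊤) (n : ℕ) : g m ν Ω (n + 1) ≤ g m ν Ω n :=
  ENNReal.toReal_mono (lintegral_stayProb_ne_top hfin n) (lintegral_mono (stayProb_succ_le n))

/-- The real-valued function `1_Ω(x) ·` `stayProb m Ω n x`. -/
noncomputable def stayFun (m : Kernel X X) (Ω : Set X) (n : ℕ) : X → ℝ :=
  Ω.indicator fun x => (stayProb m Ω n x).toReal

theorem integral_stayFun [IsMarkovKernel m] (hΩ : MeasurableSet Ω) (n : ℕ) (x : X) :
    ∫ y, stayFun m Ω n y ∂m x = (stayProb m Ω (n + 1) x).toReal := by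
  rw [stayFun, integral_indicator hΩ, integral_toReal]
  · rfl
  · exact (measurable_stayProb hΩ n).aemeasurable
  · exact ae_of_all _ fun x => (stayProb_ne_top n x).lt_top

theorem integral_stayFun_mul [IsMarkovKernel m] (hrev : m.IsReversible ν)
    (hΩ : MeasurableSet Ω) (a b : ℕ) :
    ∫ x, stayFun m Ω a x * stayFun m Ω b x ∂ν = g m ν Ω (a + b) := by
  have h : ∀ x, stayFun m Ω a x * stayFun m Ω b x
      = Ω.indicator (fun x => (stayProb m Ω a x * stayProb m Ω b x).toReal) x := by
    intro x; by_cases hx : x ∈ Ω <;> simp [stayFun, hx]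
  simp_rw [h]
  rw [integral_indicator hΩ, integral_toReal, lintegral_stayProb_mul hrev hΩ]
  · rfl
  · exact ((measurable_stayProb hΩ a).mul (measurable_stayProb hΩ b)).aemeasurable
  · exact ae_of_all _ fun x => ENNReal.mul_lt_top (stayProb_ne_top a x).lt_top
      (stayProb_ne_top b x).lt_top

end StayProb

section Decay

variable {X : Type*} [MeasurableSpace X] {m : Kernel X X} {ν : Measure X} {Ω : Set X}

theorem memLp_stayFun [IsMarkovKernel m] (hΩ : MeasurableSet Ω) (hfin : ν Ω ≠ ⊤) (n : ℕ) :
    MemLp (stayFun m Ω n) 2 ν := by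
  have : IsFiniteMeasure (ν.restrict Ω) := ⟨by simpa using hfin.lt_top⟩
  rw [stayFun, memLp_indicator_iff_restrict hΩ]
  refine MemLp.of_bound (measurable_stayProb hΩ n).ennreal_toReal.aestronglyMeasurable 1
    (ae_of_all _ fun x => ?_)
  rw [Real.norm_of_nonneg ENNReal.toReal_nonneg]
  exact ENNReal.toReal_mono ENNReal.one_ne_top (stayProb_le_one n x)

theorem measurePreserving_fst_compProd [SigmaFinite ν] [IsMarkovKernel m] :
    MeasurePreserving Prod.fst (ν ⊗ₘ m) ν :=
  ⟨measurable_fst, Measure.fst_compProd ν m⟩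

theorem measurePreserving_snd_compProd [SigmaFinite ν] [IsMarkovKernel m]
    (hrev : m.IsReversible ν) : MeasurePreserving Prod.snd (ν ⊗ₘ m) ν :=
  ⟨measurable_snd, (Measure.snd_compProd ν m).trans hrev.invariant.def⟩

theorem integral_sub_sq_stayFun [SigmaFinite ν] [IsMarkovKernel m] (hrev : m.IsReversible ν)
    (hΩ : MeasurableSet Ω) (hfin : ν Ω ≠ ⊤) (k : ℕ) :
    Integrable (fun z : X × X => (stayFun m Ω k z.2 - stayFun m Ω k z.1) ^ 2) (ν ⊗ₘ m) ∧
    ∫ z, (stayFun m Ω k z.2 - stayFun m Ω k z.1) ^ 2 ∂(ν ⊗ₘ m) =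
      2 * g m ν Ω (k + k) - 2 * g m ν Ω (k + k + 1) := by
  set f := stayFun m Ω k with hf
  have hL : MemLp f 2 ν := memLp_stayFun hΩ hfin k
  have h1 := measurePreserving_fst_compProd (ν := ν) (m := m)
  have h2 := measurePreserving_snd_compProd hrev
  have hL1 : MemLp (fun z : X × X => f z.1) 2 (ν ⊗ₘ m) := hL.comp_measurePreserving h1
  have hL2 : MemLp (fun z : X × X => f z.2) 2 (ν ⊗ₘ m) := hL.comp_measurePreserving h2
  have hmul : Integrable (fun z : X × X => f z.1 * f z.2) (ν ⊗ₘ m) := hL1.integrable_mul hL2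
  refine ⟨(hL2.sub hL1).integrable_sq, ?_⟩
  have hsq : ∫ x, f x ^ 2 ∂ν = g m ν Ω (k + k) := by
    rw [← integral_stayFun_mul hrev hΩ]; simp_rw [sq, hf]
  have e1 : ∫ z : X × X, f z.1 ^ 2 ∂(ν ⊗ₘ m) = g m ν Ω (k + k) := by
    rw [← hsq]
    conv_rhs => rw [← h1.map_eq]
    exact (integral_map h1.aemeasurable
      (by rw [h1.map_eq]; exact hL.integrable_sq.aestronglyMeasurable)).symm
  have e2 : ∫ z : X × X, f z.2 ^ 2 ∂(ν ⊗ₘ m) = g m ν Ω (k + k) := by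
    rw [← hsq]
    conv_rhs => rw [← h2.map_eq]
    exact (integral_map h2.aemeasurable
      (by rw [h2.map_eq]; exact hL.integrable_sq.aestronglyMeasurable)).symm
  have e3 : ∫ z : X × X, f z.1 * f z.2 ∂(ν ⊗ₘ m) = g m ν Ω (k + k + 1) := by
    rw [Measure.integral_compProd hmul, add_assoc, ← integral_stayFun_mul hrev hΩ]
    refine integral_congr_ae (ae_of_all _ fun x => ?_)
    simp only [integral_const_mul]
    rw [hf, integral_stayFun hΩ]
    by_cases hx : x ∈ Ω <;> simp [stayFun, hx]
  calc ∫ z : X × X, (f z.2 - f z.1) ^ 2 ∂(ν ⊗ₘ m)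
      = ∫ z : X × X, (f z.2 ^ 2 + f z.1 ^ 2 - 2 * (f z.1 * f z.2)) ∂(ν ⊗ₘ m) := by
        congr 1 with z; ring
    _ = _ := by
        rw [integral_sub (f := fun z : X × X => f z.2 ^ 2 + f z.1 ^ 2)
            (hL2.integrable_sq.add hL1.integrable_sq) (hmul.const_mul 2),
          integral_add hL2.integrable_sq hL1.integrable_sq, integral_const_mul, e1, e2, e3]
        ring

/-- The Poincaré inequality forces a geometric decay of `g_{m,Ω}`. -/
theorem exists_g_le_geometric [SigmaFinite ν] [IsMarkovKernel m] (hrev : m.IsReversible ν)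
    (hΩ : MeasurableSet Ω) (hfin : ν Ω ≠ ⊤) (hpoinc : SatisfiesTwoPoincare m ν Ω) :
    ∃ C r : ℝ, 0 ≤ r ∧ r < 1 ∧ ∀ k, g m ν Ω k ≤ C * r ^ k := by
  obtain ⟨c, hc, hP⟩ := hpoinc
  have step : ∀ k, g m ν Ω (k + k + 1) ≤ (1 - c / 2) * g m ν Ω (k + k) := by
    intro k
    have hL : MemLp (stayFun m Ω k) 2 ν := memLp_stayFun hΩ hfin k
    obtain ⟨hint, heq⟩ := integral_sub_sq_stayFun hrev hΩ hfin k
    have h := hP (stayFun m Ω k) (hL.restrict _) (by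
      filter_upwards [ae_restrict_mem (measurableSet_mBoundary m hΩ)] with x hx
      exact indicator_of_notMem hx.1 _)
    have h2 : ∫ z in mClosure m Ω ×ˢ mClosure m Ω,
        (stayFun m Ω k z.2 - stayFun m Ω k z.1) ^ 2 ∂(ν ⊗ₘ m) ≤ _ :=
      setIntegral_le_integral hint (ae_of_all _ fun z => sq_nonneg _)
    have h3 : ∫ x in Ω, stayFun m Ω k x ^ 2 ∂ν = g m ν Ω (k + k) := by
      rw [← integral_stayFun_mul hrev hΩ, setIntegral_eq_integral_of_forall_compl_eq_zero]
      · simp_rw [sq]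
      · intro x hx; simp [stayFun, hx]
    rw [h3] at h
    rw [heq] at h2
    linarith
  set q := max (1 - c / 2) (1 / 2) with hq
  have hq0 : 0 < q := lt_max_of_lt_right (by norm_num)
  have hq1 : q < 1 := max_lt (by linarith) (by norm_num)
  have hg0 := fun k => g_nonneg (m := m) (ν := ν) (Ω := Ω) k
  have even : ∀ k, g m ν Ω (2 * k) ≤ g m ν Ω 0 * q ^ k := by
    intro k
    induction k with
    | zero => simp
    | succ k ih =>
      calc g m ν Ω (2 * (k + 1)) ≤ g m ν Ω (2 * k + 1) := g_succ_le hfin _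
        _ ≤ (1 - c / 2) * g m ν Ω (2 * k) := by have := step k; rwa [← two_mul] at this
        _ ≤ q * (g m ν Ω 0 * q ^ k) := by
          exact mul_le_mul (le_max_left _ _) ih (hg0 _) hq0.le
        _ = g m ν Ω 0 * q ^ (k + 1) := by ring
  have hs0 : 0 < √q := Real.sqrt_pos.2 hq0
  have hsq : √q ^ 2 = q := Real.sq_sqrt hq0.le
  have hs1 : √q < 1 := by rw [Real.sqrt_lt' one_pos]; simpa using hq1
  refine ⟨g m ν Ω 0 / √q, √q, hs0.le, hs1, fun k => ?_⟩
  obtain ⟨n, rfl | rfl⟩ := Nat.even_or_odd' k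
  · refine (even n).trans ?_
    rw [pow_mul, hsq]
    gcongr
    rw [le_div_iff₀ hs0]
    exact mul_le_of_le_one_right (hg0 0) hs1.le
  · refine ((g_succ_le hfin _).trans (even n)).trans_eq ?_
    rw [pow_succ, pow_mul, hsq]
    field_simp

theorem summable_choose_mul_g [SigmaFinite ν] [IsMarkovKernel m] (hrev : m.IsReversible ν)
    (hΩ : MeasurableSet Ω) (hfin : ν Ω ≠ ⊤) (hpoinc : SatisfiesTwoPoincare m ν Ω) (i : ℕ) :
    Summable fun k : ℕ => ((k + i).choose i : ℝ) * g m ν Ω k := by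
  obtain ⟨C, r, hr0, hr1, h⟩ := exists_g_le_geometric hrev hΩ hfin hpoinc
  have hr : ‖r‖ < 1 := by rwa [Real.norm_of_nonneg hr0]
  refine Summable.of_nonneg_of_le (fun k => mul_nonneg (Nat.cast_nonneg _) (g_nonneg k))
    (fun k => ?_) ((summable_choose_mul_geometric_of_norm_lt_one i hr).mul_left C)
  calc ((k + i).choose i : ℝ) * g m ν Ω k ≤ ((k + i).choose i : ℝ) * (C * r ^ k) :=
        mul_le_mul_of_nonneg_left (h k) (Nat.cast_nonneg _)
    _ = C * (((k + i).choose i : ℝ) * r ^ k) := by ring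

end Decay

section Moments

theorem integrableOn_pow_mul_exp_neg (n : ℕ) :
    IntegrableOn (fun t : ℝ => t ^ n * Real.exp (-t)) (Ioi 0) := by
  have h := Real.GammaIntegral_convergent (s := n + 1) (by positivity)
  simpa [Real.rpow_natCast, mul_comm] using h

theorem integral_pow_mul_exp_neg (n : ℕ) :
    ∫ t in Ioi (0 : ℝ), t ^ n * Real.exp (-t) = (n.factorial : ℝ) := by
  rw [← Real.Gamma_nat_eq_factorial, Real.Gamma_eq_integral (by positivity)]
  simp [Real.rpow_natCast, mul_comm]

/-- Term-by-term integration of a Poissonized sequence against `t ^ i`. -/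
theorem integral_pow_mul_poisson {a : ℕ → ℝ} (ha : ∀ k, 0 ≤ a k) {Q : ℝ → ℝ}
    (hQ : ∀ t, HasSum (fun k : ℕ => Real.exp (-t) * (t ^ k / k.factorial * a k)) (Q t)) (i : ℕ)
    (hsum : Summable fun k : ℕ => ((k + i).choose i : ℝ) * a k) :
    IntegrableOn (fun t : ℝ => t ^ i * Q t) (Ioi 0) ∧
      ∫ t in Ioi (0 : ℝ), t ^ i * Q t =
        (i.factorial : ℝ) * ∑' k : ℕ, ((k + i).choose i : ℝ) * a k := by
  set F : ℕ → ℝ → ℝ := fun k t => a k / k.factorial * (t ^ (k + i) * Real.exp (-t)) with hF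
  have hFi : ∀ k, Integrable (F k) (volume.restrict (Ioi 0)) := fun k =>
    (integrableOn_pow_mul_exp_neg (k + i)).const_mul _
  have hFnn : ∀ k, ∀ t ∈ Ioi (0 : ℝ), 0 ≤ F k t := fun k t ht => by
    have : (0 : ℝ) < t := ht
    have := ha k
    positivity
  have hFint : ∀ k, ∫ t in Ioi (0 : ℝ), F k t = i.factorial * (((k + i).choose i : ℝ) * a k) := by
    intro k
    rw [hF, integral_const_mul, integral_pow_mul_exp_neg]
    have h := Nat.add_choose_mul_factorial_mul_factorial k i
    rw [← h]
    push_cast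
    field_simp
  have hnorm : ∀ k, ∫ t in Ioi (0 : ℝ), ‖F k t‖ = ∫ t in Ioi (0 : ℝ), F k t := fun k =>
    setIntegral_congr_fun measurableSet_Ioi fun t ht => Real.norm_of_nonneg (hFnn k t ht)
  have hS : Summable fun k => ∫ t in Ioi (0 : ℝ), ‖F k t‖ := by
    simp_rw [hnorm, hFint]
    exact hsum.mul_left _
  have hFQ : ∀ t, HasSum (fun k => F k t) (t ^ i * Q t) := fun t => by
    have h := (hQ t).mul_left (t ^ i)
    refine h.congr_fun ?_
    intro k
    simp only [hF]; ring
  have hval := hasSum_integral_of_summable_integral_norm hFi hS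
  simp_rw [fun t => (hFQ t).tsum_eq, hFint] at hval
  refine ⟨?_, by rw [← tsum_mul_left]; exact hval.tsum_eq.symm⟩
  by_cases h0 : ∫ t in Ioi (0 : ℝ), t ^ i * Q t = 0
  · rw [h0, hasSum_zero_iff_of_nonneg fun k => by have := ha k; positivity] at hval
    have ha0 : ∀ k, a k = 0 := fun k => by
      have h := congr_fun hval k
      have hc : (k + i).choose i ≠ 0 := (Nat.choose_pos (Nat.le_add_left i k)).ne'
      simpa [hc, Nat.factorial_ne_zero] using h
    have hQ0 : ∀ t, Q t = 0 := fun t => by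
      have h := hQ t
      simp only [ha0, mul_zero] at h
      exact h.unique hasSum_zero
    simp [hQ0]
  · exact Integrable.of_integral_ne_zero h0

end Moments

section Operator

variable {X : Type*} [MeasurableSpace X] {m : Kernel X X} {ν : Measure X} {Ω : Set X}

theorem enorm_integral_sq_le {μ : Measure X} [IsProbabilityMeasure μ] {f : X → ℝ}
    (hf : AEStronglyMeasurable f μ) : ‖∫ x, f x ∂μ‖ₑ ^ 2 ≤ ∫⁻ x, ‖f x‖ₑ ^ 2 ∂μ := by
  have h2 : eLpNorm f 2 μ ^ 2 = ∫⁻ x, ‖f x‖ₑ ^ 2 ∂μ := by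
    simpa using eLpNorm_nnreal_pow_eq_lintegral (μ := μ) (f := f) (p := 2) two_ne_zero
  rw [← h2]
  gcongr
  calc ‖∫ x, f x ∂μ‖ₑ ≤ ∫⁻ x, ‖f x‖ₑ ∂μ := enorm_integral_le_lintegral_enorm f
    _ = eLpNorm f 1 μ := eLpNorm_one_eq_lintegral_enorm.symm
    _ ≤ eLpNorm f 2 μ := eLpNorm_le_eLpNorm_of_exponent_le one_le_two hf

/-- The averaging operator of the Dirichlet problem: `f ↦ 1_Ω ∫_{Ω_m} f dm_x`. -/
noncomputable def dirichletFun (m : Kernel X X) (Ω : Set X) (f : X → ℝ) : X → ℝ :=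
  Ω.indicator fun x => ∫ y in mClosure m Ω, f y ∂m x

theorem ae_ae_mClosure [IsMarkovKernel m] (hrev : m.IsReversible ν) (hΩ : MeasurableSet Ω)
    {p : X → Prop} (hp : ∀ᵐ x ∂ν.restrict (mClosure m Ω), p x) :
    ∀ᵐ x ∂ν, ∀ᵐ y ∂(m x).restrict (mClosure m Ω), p y := by
  have hC := measurableSet_mClosure m hΩ
  rw [ae_restrict_iff' hC] at hp
  filter_upwards [ae_ae_of_isReversible hrev hp] with x hx
  rwa [ae_restrict_iff' hC]

theorem dirichletFun_congr [IsMarkovKernel m] (hrev : m.IsReversible ν) (hΩ : MeasurableSet Ω)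
    {f h : X → ℝ} (hfh : f =ᵐ[ν.restrict (mClosure m Ω)] h) :
    dirichletFun m Ω f =ᵐ[ν] dirichletFun m Ω h := by
  filter_upwards [ae_ae_mClosure hrev hΩ hfh] with x hx
  simp only [dirichletFun, indicator]
  rw [integral_congr_ae hx]

theorem stronglyMeasurable_dirichletFun [IsMarkovKernel m] (hΩ : MeasurableSet Ω)
    {f : X → ℝ} (hf : StronglyMeasurable f) : StronglyMeasurable (dirichletFun m Ω f) := by
  have hC := measurableSet_mClosure m hΩ
  simp_rw [dirichletFun, ← integral_indicator hC]
  exact (hf.indicator hC).integral_kernel.indicator hΩ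

theorem lintegral_lintegral_mClosure [IsMarkovKernel m] (hrev : m.IsReversible ν)
    (hΩ : MeasurableSet Ω) {f : X → ENNReal} (hf : Measurable f) :
    ∫⁻ x, ∫⁻ y in mClosure m Ω, f y ∂m x ∂ν = ∫⁻ x in mClosure m Ω, f x ∂ν := by
  have hC := measurableSet_mClosure m hΩ
  simp_rw [← lintegral_indicator hC]
  exact lintegral_lintegral_of_isReversible hrev (hf.indicator hC)

theorem eLpNorm_dirichletFun_le [IsMarkovKernel m] (hrev : m.IsReversible ν)
    (hΩ : MeasurableSet Ω) {f : X → ℝ} (hf : StronglyMeasurable f) :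
    eLpNorm (dirichletFun m Ω f) 2 (ν.restrict (mClosure m Ω)) ≤
      eLpNorm f 2 (ν.restrict (mClosure m Ω)) := by
  have hC := measurableSet_mClosure m hΩ
  have h2 : ∀ h : X → ℝ, eLpNorm h 2 (ν.restrict (mClosure m Ω)) ^ 2 =
      ∫⁻ x in mClosure m Ω, ‖h x‖ₑ ^ 2 ∂ν := fun h => by
    simpa using eLpNorm_nnreal_pow_eq_lintegral (μ := ν.restrict (mClosure m Ω)) (f := h)
      (p := 2) two_ne_zero
  rw [← ENNReal.pow_le_pow_left_iff two_ne_zero, h2, h2,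
    ← lintegral_lintegral_mClosure hrev hΩ (hf.enorm.pow_const 2)]
  refine (setLIntegral_le_lintegral _ _).trans (lintegral_mono fun x => ?_)
  have h3 : ‖∫ y in mClosure m Ω, f y ∂m x‖ₑ ^ 2 ≤ ∫⁻ y in mClosure m Ω, ‖f y‖ₑ ^ 2 ∂m x := by
    rw [← integral_indicator hC, ← lintegral_indicator hC]
    refine (enorm_integral_sq_le (hf.indicator hC).aestronglyMeasurable).trans_eq ?_
    refine lintegral_congr fun y => ?_
    by_cases hy : y ∈ mClosure m Ω <;> simp [hy]
  by_cases hx : x ∈ Ω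
  · simpa [dirichletFun, hx] using h3
  · simp [dirichletFun, hx]

theorem ae_integrableOn_mClosure [IsMarkovKernel m] (hrev : m.IsReversible ν)
    (hΩ : MeasurableSet Ω) {f : X → ℝ} (hf : MemLp f 2 (ν.restrict (mClosure m Ω))) :
    ∀ᵐ x ∂ν, IntegrableOn f (mClosure m Ω) (m x) := by
  set h := hf.1.mk f with hh
  have hhm : StronglyMeasurable h := hf.1.stronglyMeasurable_mk
  have hfh : f =ᵐ[ν.restrict (mClosure m Ω)] h := hf.1.ae_eq_mk
  have hL : MemLp h 2 (ν.restrict (mClosure m Ω)) := hf.ae_eq hfh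
  have hmeas : Measurable fun x => ‖h x‖ₑ ^ 2 := hhm.enorm.pow_const 2
  have hC := measurableSet_mClosure m hΩ
  have hlt : ∫⁻ x, ∫⁻ y in mClosure m Ω, ‖h y‖ₑ ^ 2 ∂m x ∂ν ≠ ⊤ := by
    rw [lintegral_lintegral_mClosure hrev hΩ hmeas]
    have h2 : eLpNorm h 2 (ν.restrict (mClosure m Ω)) ^ 2 =
        ∫⁻ x in mClosure m Ω, ‖h x‖ₑ ^ 2 ∂ν := by
      simpa using eLpNorm_nnreal_pow_eq_lintegral (μ := ν.restrict (mClosure m Ω)) (f := h)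
        (p := 2) two_ne_zero
    rw [← h2]
    exact ENNReal.pow_ne_top hL.2.ne
  have hkm : Measurable fun x => ∫⁻ y in mClosure m Ω, ‖h y‖ₑ ^ 2 ∂m x := by
    simp_rw [← lintegral_indicator hC]
    exact (hmeas.indicator hC).lintegral_kernel
  filter_upwards [ae_lt_top hkm hlt, ae_ae_mClosure hrev hΩ hfh] with x hx hxe
  have hxe' : h =ᵐ[(m x).restrict (mClosure m Ω)] f := Filter.EventuallyEq.symm hxe
  refine Integrable.congr ?_ hxe'
  refine MemLp.integrable one_le_two ⟨hhm.aestronglyMeasurable, ?_⟩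
  have h2 : eLpNorm h 2 ((m x).restrict (mClosure m Ω)) ^ 2 =
      ∫⁻ y in mClosure m Ω, ‖h y‖ₑ ^ 2 ∂m x := by
    simpa using eLpNorm_nnreal_pow_eq_lintegral (μ := (m x).restrict (mClosure m Ω)) (f := h)
      (p := 2) two_ne_zero
  rw [← h2] at hx
  exact (ENNReal.pow_lt_top_iff.1 hx).resolve_right two_ne_zero

theorem memLp_dirichletFun [IsMarkovKernel m] (hrev : m.IsReversible ν) (hΩ : MeasurableSet Ω)
    (f : Lp ℝ 2 (ν.restrict (mClosure m Ω))) :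
    MemLp (dirichletFun m Ω f) 2 (ν.restrict (mClosure m Ω)) :=
  ⟨(stronglyMeasurable_dirichletFun hΩ (Lp.stronglyMeasurable f)).aestronglyMeasurable,
    (eLpNorm_dirichletFun_le hrev hΩ (Lp.stronglyMeasurable f)).trans_lt (Lp.eLpNorm_lt_top f)⟩

/-- The averaging operator of the Dirichlet problem on `L²(Ω_m, ν)`. -/
noncomputable def dirichletOp [IsMarkovKernel m] (hrev : m.IsReversible ν)
    (hΩ : MeasurableSet Ω) :
    Lp ℝ 2 (ν.restrict (mClosure m Ω)) →L[ℝ] Lp ℝ 2 (ν.restrict (mClosure m Ω)) :=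
  LinearMap.mkContinuous
    { toFun := fun f => (memLp_dirichletFun hrev hΩ f).toLp
      map_add' := fun f h => by
        rw [← MemLp.toLp_add, MemLp.toLp_eq_toLp_iff]
        refine Filter.EventuallyEq.trans
          (ae_restrict_of_ae (dirichletFun_congr hrev hΩ (Lp.coeFn_add f h))) ?_
        filter_upwards [ae_restrict_of_ae (ae_integrableOn_mClosure hrev hΩ (Lp.memLp f)),
          ae_restrict_of_ae (ae_integrableOn_mClosure hrev hΩ (Lp.memLp h))] with x hf hh
        by_cases hx : x ∈ Ω
        · simpa [dirichletFun, hx] using integral_add hf hh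
        · simp [dirichletFun, hx]
      map_smul' := fun c f => by
        rw [RingHom.id_apply, ← MemLp.toLp_const_smul, MemLp.toLp_eq_toLp_iff]
        refine Filter.EventuallyEq.trans
          (ae_restrict_of_ae (dirichletFun_congr hrev hΩ (Lp.coeFn_smul c f))) ?_
        refine ae_of_all _ fun x => ?_
        by_cases hx : x ∈ Ω
        · simpa [dirichletFun, hx] using integral_const_mul c _
        · simp [dirichletFun, hx] }
    1 fun f => by
      rw [one_mul]
      change ‖MemLp.toLp (dirichletFun m Ω f) (memLp_dirichletFun hrev hΩ f)‖ ≤ _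
      rw [Lp.norm_toLp, Lp.norm_def]
      exact ENNReal.toReal_mono (Lp.eLpNorm_ne_top f)
        (eLpNorm_dirichletFun_le hrev hΩ (Lp.stronglyMeasurable f))

theorem norm_dirichletOp_apply_le [IsMarkovKernel m] (hrev : m.IsReversible ν)
    (hΩ : MeasurableSet Ω) (f : Lp ℝ 2 (ν.restrict (mClosure m Ω))) :
    ‖dirichletOp hrev hΩ f‖ ≤ ‖f‖ := by
  simpa using (dirichletOp hrev hΩ).le_of_opNorm_le
    (LinearMap.mkContinuous_norm_le _ zero_le_one _) f

theorem coeFn_dirichletOp [IsMarkovKernel m] (hrev : m.IsReversible ν) (hΩ : MeasurableSet Ω)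
    (f : Lp ℝ 2 (ν.restrict (mClosure m Ω))) :
    dirichletOp hrev hΩ f =ᵐ[ν.restrict (mClosure m Ω)] dirichletFun m Ω f :=
  MemLp.coeFn_toLp (memLp_dirichletFun hrev hΩ f)

/-- On `Ω`, the right-hand side of the heat equation is `dirichletOp f - f`. -/
theorem integral_sub_ae_eq_dirichletOp_sub [IsMarkovKernel m] (hrev : m.IsReversible ν)
    (hΩ : MeasurableSet Ω) (f : Lp ℝ 2 (ν.restrict (mClosure m Ω))) :
    ∀ᵐ x ∂ν.restrict Ω, ∫ y in mClosure m Ω, (f y - f x) ∂m x =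
      (dirichletOp hrev hΩ f - f : Lp ℝ 2 (ν.restrict (mClosure m Ω))) x := by
  filter_upwards [ae_restrict_of_ae_restrict_of_subset subset_mClosure (coeFn_dirichletOp hrev hΩ f),
    ae_restrict_of_ae_restrict_of_subset subset_mClosure (Lp.coeFn_sub (dirichletOp hrev hΩ f) f),
    ae_restrict_of_ae (ae_integrableOn_mClosure hrev hΩ (Lp.memLp f)),
    ae_measure_mClosure_eq_one hrev hΩ, ae_restrict_mem hΩ] with x h1 h2 h3 h4 h5
  rw [h2, Pi.sub_apply, h1, integral_sub h3 (integrable_const _)]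
  simp [dirichletFun, h5, measureReal_def, h4]

/-- The element of `L²(Ω_m, ν)` given by `stayFun m Ω n`. -/
noncomputable def stayLp (m : Kernel X X) [IsMarkovKernel m] (hΩ : MeasurableSet Ω) (hfin : ν Ω ≠ ⊤) (n : ℕ) :
    Lp ℝ 2 (ν.restrict (mClosure m Ω)) :=
  ((memLp_stayFun (m := m) hΩ hfin n).restrict (mClosure m Ω)).toLp

theorem coeFn_stayLp [IsMarkovKernel m] (hΩ : MeasurableSet Ω) (hfin : ν Ω ≠ ⊤) (n : ℕ) :
    stayLp m hΩ hfin n =ᵐ[ν.restrict (mClosure m Ω)] stayFun m Ω n :=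
  MemLp.coeFn_toLp ((memLp_stayFun (m := m) hΩ hfin n).restrict (mClosure m Ω))

theorem dirichletFun_stayFun [IsMarkovKernel m] (hΩ : MeasurableSet Ω) (n : ℕ) :
    dirichletFun m Ω (stayFun m Ω n) = stayFun m Ω (n + 1) := by
  ext x
  rw [dirichletFun, show stayFun m Ω (n + 1) x =
    Ω.indicator (fun x => (stayProb m Ω (n + 1) x).toReal) x from rfl]
  congr 2 with x
  rw [setIntegral_eq_integral_of_forall_compl_eq_zero, integral_stayFun hΩ]
  intro y hy
  exact indicator_of_notMem (fun h => hy (subset_mClosure h)) _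

theorem dirichletOp_pow_stayLp [IsMarkovKernel m] (hrev : m.IsReversible ν)
    (hΩ : MeasurableSet Ω) (hfin : ν Ω ≠ ⊤) (n : ℕ) :
    (dirichletOp hrev hΩ ^ n) (stayLp m hΩ hfin 0) = stayLp m hΩ hfin n := by
  induction n with
  | zero => simp
  | succ n ih =>
    rw [pow_succ', mul_apply_eq_comp, ih]
    refine Lp.ext ?_
    have h : dirichletFun m Ω (stayLp m hΩ hfin n) =ᵐ[ν.restrict (mClosure m Ω)]
        dirichletFun m Ω (stayFun m Ω n) :=
      ae_restrict_of_ae (dirichletFun_congr hrev hΩ (coeFn_stayLp hΩ hfin n))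
    rw [dirichletFun_stayFun hΩ] at h
    exact ((coeFn_dirichletOp hrev hΩ _).trans h).trans (coeFn_stayLp hΩ hfin _).symm

end Operator

section Evolution

variable {X : Type*} [MeasurableSpace X] {m : Kernel X X} {ν : Measure X} {Ω : Set X}

theorem ae_restrict_mClosure_iff {p : X → Prop} :
    (∀ᵐ x ∂ν.restrict (mClosure m Ω), p x) ↔
      (∀ᵐ x ∂ν.restrict Ω, p x) ∧ ∀ᵐ x ∂ν.restrict (mBoundary m Ω), p x :=
  ae_restrict_union_iff _ _ _

theorem lp_ext_mClosure {f h : Lp ℝ 2 (ν.restrict (mClosure m Ω))}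
    (h1 : ∀ᵐ x ∂ν.restrict Ω, f x = h x) (h2 : ∀ᵐ x ∂ν.restrict (mBoundary m Ω), f x = h x) :
    f = h :=
  Lp.ext (ae_restrict_mClosure_iff.2 ⟨h1, h2⟩)

/-- Restriction of functions in `L²(Ω_m, ν)` to the `m`-boundary. -/
noncomputable def boundaryRestrict (m : Kernel X X) (ν : Measure X) (Ω : Set X) :
    Lp ℝ 2 (ν.restrict (mClosure m Ω)) →L[ℝ]
      Lp ℝ 2 ((ν.restrict (mClosure m Ω)).restrict (mBoundary m Ω)) :=
  LpToLpRestrictCLM X ℝ ℝ (ν.restrict (mClosure m Ω)) 2 (mBoundary m Ω)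

theorem boundaryRestrict_eq_zero_iff (hΩ : MeasurableSet Ω)
    {f : Lp ℝ 2 (ν.restrict (mClosure m Ω))} :
    boundaryRestrict m ν Ω f = 0 ↔ ∀ᵐ x ∂ν.restrict (mBoundary m Ω), f x = 0 := by
  have hB := measurableSet_mBoundary m hΩ
  have hr : (ν.restrict (mClosure m Ω)).restrict (mBoundary m Ω) = ν.restrict (mBoundary m Ω) := by
    rw [Measure.restrict_restrict hB, inter_eq_left.2 mBoundary_subset_mClosure]
  have hc := LpToLpRestrictCLM_coeFn ℝ (mBoundary m Ω) f
  rw [Lp.eq_zero_iff_ae_eq_zero]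
  constructor
  · intro h
    rw [← hr]
    filter_upwards [h, hc] with x h1 h2
    exact h2.symm.trans h1
  · intro h
    rw [← hr] at h
    filter_upwards [h, hc] with x h1 h2
    exact h2.trans h1

theorem boundaryRestrict_dirichletOp [IsMarkovKernel m] (hrev : m.IsReversible ν)
    (hΩ : MeasurableSet Ω) (f : Lp ℝ 2 (ν.restrict (mClosure m Ω))) :
    boundaryRestrict m ν Ω (dirichletOp hrev hΩ f) = 0 := by
  rw [boundaryRestrict_eq_zero_iff hΩ]
  filter_upwards [ae_restrict_of_ae_restrict_of_subset mBoundary_subset_mClosure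
    (coeFn_dirichletOp hrev hΩ f), ae_restrict_mem (measurableSet_mBoundary m hΩ)] with x h1 h2
  rw [h1]
  exact indicator_of_notMem h2.1 _

theorem boundaryRestrict_stayLp [IsMarkovKernel m] (hΩ : MeasurableSet Ω) (hfin : ν Ω ≠ ⊤)
    (n : ℕ) : boundaryRestrict m ν Ω (stayLp m hΩ hfin n) = 0 := by
  rw [boundaryRestrict_eq_zero_iff hΩ]
  filter_upwards [ae_restrict_of_ae_restrict_of_subset mBoundary_subset_mClosure
    (coeFn_stayLp hΩ hfin n), ae_restrict_mem (measurableSet_mBoundary m hΩ)] with x h1 h2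
  rw [h1]
  exact indicator_of_notMem h2.1 _

theorem stayLp_zero_ae_eq_one [IsMarkovKernel m] (hΩ : MeasurableSet Ω) (hfin : ν Ω ≠ ⊤) :
    ∀ᵐ x ∂ν.restrict Ω, stayLp m hΩ hfin 0 x = 1 := by
  filter_upwards [ae_restrict_of_ae_restrict_of_subset subset_mClosure
    (coeFn_stayLp (m := m) hΩ hfin 0), ae_restrict_mem hΩ] with x h1 h2
  rw [h1]
  simp [stayFun, stayProb, h2]

theorem setIntegral_eq_inner_stayLp_zero [IsMarkovKernel m] (hΩ : MeasurableSet Ω)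
    (hfin : ν Ω ≠ ⊤) (f : Lp ℝ 2 (ν.restrict (mClosure m Ω))) :
    ∫ x in Ω, f x ∂ν = inner ℝ (stayLp m hΩ hfin 0) f := by
  rw [L2.inner_def, ← restrict_restrict_mClosure (m := m) hΩ, ← integral_indicator hΩ]
  refine integral_congr_ae ?_
  filter_upwards [coeFn_stayLp (m := m) hΩ hfin 0] with x hx
  rw [hx]
  by_cases h : x ∈ Ω <;> simp [stayFun, stayProb, h]

theorem inner_stayLp [IsMarkovKernel m] (hrev : m.IsReversible ν) (hΩ : MeasurableSet Ω)
    (hfin : ν Ω ≠ ⊤) (n : ℕ) :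
    inner ℝ (stayLp m hΩ hfin 0) (stayLp m hΩ hfin n) = g m ν Ω n := by
  rw [← setIntegral_eq_inner_stayLp_zero, ← zero_add n, ← integral_stayFun_mul hrev hΩ,
    ← integral_indicator hΩ]
  have h := coeFn_stayLp (m := m) hΩ hfin n
  rw [zero_add]
  refine integral_congr_ae ?_
  rw [Filter.EventuallyEq, ae_restrict_iff' (measurableSet_mClosure m hΩ)] at h
  filter_upwards [h] with x hx
  by_cases hxΩ : x ∈ Ω
  · simp [stayFun, stayProb, hxΩ, hx (subset_mClosure hxΩ)]
  · simp [stayFun, hxΩ]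

/-- The evolution `e^{-t} exp(t T) 1_Ω`, where `T` is the averaging operator. -/
noncomputable def heatFlow [IsMarkovKernel m] (hrev : m.IsReversible ν) (hΩ : MeasurableSet Ω)
    (hfin : ν Ω ≠ ⊤) (t : ℝ) : Lp ℝ 2 (ν.restrict (mClosure m Ω)) :=
  Real.exp (-t) • NormedSpace.exp (t • dirichletOp hrev hΩ) (stayLp m hΩ hfin 0)

theorem hasDerivAt_heatFlow [IsMarkovKernel m] (hrev : m.IsReversible ν) (hΩ : MeasurableSet Ω)
    (hfin : ν Ω ≠ ⊤) (t : ℝ) :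
    HasDerivAt (heatFlow hrev hΩ hfin)
      (dirichletOp hrev hΩ (heatFlow hrev hΩ hfin t) - heatFlow hrev hΩ hfin t) t := by
  have h1 : HasDerivAt (fun t : ℝ => Real.exp (-t)) (-Real.exp (-t)) t := by
    simpa using (hasDerivAt_neg t).exp
  have h2 := (hasDerivAt_exp_smul_const' (𝕂 := ℝ) (dirichletOp hrev hΩ) t).clm_apply
    (hasDerivAt_const t (stayLp m hΩ hfin 0))
  refine (h1.smul h2).congr_deriv ?_
  simp [heatFlow, sub_eq_add_neg]

theorem hasSum_heatFlow [IsMarkovKernel m] (hrev : m.IsReversible ν) (hΩ : MeasurableSet Ω)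
    (hfin : ν Ω ≠ ⊤) (t : ℝ) :
    HasSum (fun k : ℕ => Real.exp (-t) • (t ^ k / k.factorial : ℝ) • stayLp m hΩ hfin k)
      (heatFlow hrev hΩ hfin t) := by
  have h := NormedSpace.exp_series_hasSum_exp' (𝕂 := ℝ) (t • dirichletOp hrev hΩ)
  have h2 := (ContinuousLinearMap.apply ℝ _ (stayLp m hΩ hfin 0)).hasSum h
  refine (h2.const_smul (Real.exp (-t))).congr_fun fun k => ?_
  simp only [ContinuousLinearMap.apply_apply, smul_pow, smul_apply,
    dirichletOp_pow_stayLp, smul_smul, div_eq_inv_mul]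

theorem isDirichletHeatSolution_heatFlow [IsMarkovKernel m] (hrev : m.IsReversible ν)
    (hΩ : MeasurableSet Ω) (hfin : ν Ω ≠ ⊤) :
    IsDirichletHeatSolution m ν Ω (heatFlow hrev hΩ hfin) where
  continuousOn t _ := (hasDerivAt_heatFlow hrev hΩ hfin t).continuousAt.continuousWithinAt
  differentiableAt t _ := (hasDerivAt_heatFlow hrev hΩ hfin t).differentiableAt
  equation t _ := by
    rw [(hasDerivAt_heatFlow hrev hΩ hfin t).deriv]
    filter_upwards [integral_sub_ae_eq_dirichletOp_sub hrev hΩ (heatFlow hrev hΩ hfin t)] with x hx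
    exact hx.symm
  boundary t _ := by
    rw [← boundaryRestrict_eq_zero_iff hΩ]
    have h := (boundaryRestrict m ν Ω).hasSum (hasSum_heatFlow hrev hΩ hfin t)
    simp only [map_smul, boundaryRestrict_stayLp, smul_zero] at h
    exact h.unique hasSum_zero
  initial := by
    have h : heatFlow hrev hΩ hfin 0 = stayLp m hΩ hfin 0 := by simp [heatFlow]
    rw [h]
    exact stayLp_zero_ae_eq_one hΩ hfin

theorem hasSum_heatContent_heatFlow [IsMarkovKernel m] (hrev : m.IsReversible ν)
    (hΩ : MeasurableSet Ω) (hfin : ν Ω ≠ ⊤) (t : ℝ) :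
    HasSum (fun k : ℕ => Real.exp (-t) * (t ^ k / k.factorial * g m ν Ω k))
      (heatContent m ν Ω (heatFlow hrev hΩ hfin) t) := by
  have h := (innerSL ℝ (stayLp m hΩ hfin 0)).hasSum (hasSum_heatFlow hrev hΩ hfin t)
  rw [heatContent, setIntegral_eq_inner_stayLp_zero hΩ hfin]
  refine h.congr_fun fun k => ?_
  simp [inner_stayLp hrev]

/-- A strong solution solves the linear differential equation `w' = T w - w` in `L²(Ω_m, ν)`. -/
theorem IsDirichletHeatSolution.hasDerivAt [IsMarkovKernel m] (hrev : m.IsReversible ν)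
    (hΩ : MeasurableSet Ω) {w : ℝ → Lp ℝ 2 (ν.restrict (mClosure m Ω))}
    (hw : IsDirichletHeatSolution m ν Ω w) {t : ℝ} (ht : 0 < t) :
    HasDerivAt w (dirichletOp hrev hΩ (w t) - w t) t := by
  have hd := (hw.differentiableAt t ht).hasDerivAt
  have hR : ∀ s, 0 < s → boundaryRestrict m ν Ω (w s) = 0 := fun s hs =>
    (boundaryRestrict_eq_zero_iff hΩ).2 (hw.boundary s hs)
  have hRd : boundaryRestrict m ν Ω (deriv w t) = 0 := by
    have h1 := (boundaryRestrict m ν Ω).hasFDerivAt.comp_hasDerivAt t hd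
    have h2 : (boundaryRestrict m ν Ω ∘ w) =ᶠ[nhds t] fun _ => 0 := by
      filter_upwards [Ioi_mem_nhds ht] with s hs using hR s hs
    exact h1.unique ((hasDerivAt_const t 0).congr_of_eventuallyEq h2)
  have hR' : boundaryRestrict m ν Ω (dirichletOp hrev hΩ (w t) - w t) = 0 := by
    rw [map_sub, boundaryRestrict_dirichletOp, hR t ht, sub_zero]
  have heq : deriv w t = dirichletOp hrev hΩ (w t) - w t := by
    refine lp_ext_mClosure ?_ ?_
    · filter_upwards [hw.equation t ht, integral_sub_ae_eq_dirichletOp_sub hrev hΩ (w t)]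
        with x h1 h2
      exact h1.trans h2
    · filter_upwards [(boundaryRestrict_eq_zero_iff hΩ).1 hRd,
        (boundaryRestrict_eq_zero_iff hΩ).1 hR'] with x h1 h2
      exact h1.trans h2.symm
  rwa [heq] at hd

theorem IsDirichletHeatSolution.apply_zero [IsMarkovKernel m] (hΩ : MeasurableSet Ω)
    (hfin : ν Ω ≠ ⊤) {w : ℝ → Lp ℝ 2 (ν.restrict (mClosure m Ω))}
    (hw : IsDirichletHeatSolution m ν Ω w) : w 0 = stayLp m hΩ hfin 0 := by
  have hc : ContinuousOn (boundaryRestrict m ν Ω ∘ w) (Ici 0) :=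
    (boundaryRestrict m ν Ω).continuous.comp_continuousOn hw.continuousOn
  have h0 : boundaryRestrict m ν Ω (w 0) = 0 := by
    have h1 : Filter.Tendsto (boundaryRestrict m ν Ω ∘ w) (nhdsWithin 0 (Ioi 0))
        (nhds (boundaryRestrict m ν Ω (w 0))) :=
      (hc 0 self_mem_Ici).mono_left (nhdsWithin_mono 0 Ioi_subset_Ici_self)
    refine tendsto_nhds_unique h1 (tendsto_const_nhds.congr' ?_)
    filter_upwards [self_mem_nhdsWithin] with s hs
    exact ((boundaryRestrict_eq_zero_iff hΩ).2 (hw.boundary s hs)).symm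
  refine lp_ext_mClosure ?_ ?_
  · filter_upwards [hw.initial, stayLp_zero_ae_eq_one (m := m) hΩ hfin] with x h1 h2
    exact h1.trans h2.symm
  · filter_upwards [(boundaryRestrict_eq_zero_iff hΩ).1 h0,
      (boundaryRestrict_eq_zero_iff hΩ).1 (boundaryRestrict_stayLp (m := m) hΩ hfin 0)]
      with x h1 h2
    exact h1.trans h2.symm

theorem IsDirichletHeatSolution.eqOn [IsMarkovKernel m] (hrev : m.IsReversible ν)
    (hΩ : MeasurableSet Ω) (hfin : ν Ω ≠ ⊤) {w v : ℝ → Lp ℝ 2 (ν.restrict (mClosure m Ω))}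
    (hw : IsDirichletHeatSolution m ν Ω w) (hv : IsDirichletHeatSolution m ν Ω v) :
    EqOn w v (Ici 0) := by
  have hd : ∀ t, 0 < t → HasDerivAt (fun t => ‖w t - v t‖ ^ 2)
      (2 * inner ℝ (w t - v t) (dirichletOp hrev hΩ (w t - v t) - (w t - v t))) t := by
    intro t ht
    have h := ((hw.hasDerivAt hrev hΩ ht).sub (hv.hasDerivAt hrev hΩ ht)).norm_sq
    have e : dirichletOp hrev hΩ (w t - v t) - (w t - v t) =
        (dirichletOp hrev hΩ (w t) - w t) - (dirichletOp hrev hΩ (v t) - v t) := by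
      rw [map_sub]; abel
    rw [e]
    exact h
  have hanti : AntitoneOn (fun t => ‖w t - v t‖ ^ 2) (Ici 0) := by
    refine antitoneOn_of_deriv_nonpos (convex_Ici 0)
      ((hw.continuousOn.sub hv.continuousOn).norm.pow 2) ?_ ?_
    · rw [interior_Ici]
      exact fun t ht => (hd t ht).differentiableAt.differentiableWithinAt
    · rw [interior_Ici]
      intro t ht
      rw [(hd t ht).deriv, inner_sub_right, real_inner_self_eq_norm_sq]
      have h1 := real_inner_le_norm (w t - v t) (dirichletOp hrev hΩ (w t - v t))
      have h2 := mul_le_mul_of_nonneg_left (norm_dirichletOp_apply_le hrev hΩ (w t - v t))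
        (norm_nonneg (w t - v t))
      rw [← sq] at h2
      linarith
  intro t ht
  have h := hanti self_mem_Ici ht ht
  simp only [hw.apply_zero hΩ hfin, hv.apply_zero hΩ hfin, sub_self, norm_zero] at h
  have h0 : ‖w t - v t‖ ^ 2 = 0 := le_antisymm (by simpa using h) (sq_nonneg _)
  exact sub_eq_zero.1 (norm_eq_zero.1 (pow_eq_zero_iff two_ne_zero |>.1 h0))

end Evolution

end RandomWalk

theorem mainTheorem11 {X : Type*} [MeasurableSpace X] [MeasurableSpace.CountablyGenerated X]
    (m : Kernel X X) [IsMarkovKernel m] (ν : Measure X) [SigmaFinite ν]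
    (hrev : m.IsReversible ν)
    (Ω : Set X) (hΩ : MeasurableSet Ω)
    (hconn : RandomWalk.IsMConnected m ν Ω)
    (hpos : 0 < ν Ω) (hlt : ν Ω < ν (RandomWalk.mClosure m Ω))
    (hfin : ν (RandomWalk.mClosure m Ω) < ⊤)
    (hpoinc : RandomWalk.SatisfiesTwoPoincare m ν Ω) :
    ∃ v : ℝ → Lp ℝ 2 (ν.restrict (RandomWalk.mClosure m Ω)),
      RandomWalk.IsDirichletHeatSolution m ν Ω v ∧
      (∀ w : ℝ → Lp ℝ 2 (ν.restrict (RandomWalk.mClosure m Ω)),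
        RandomWalk.IsDirichletHeatSolution m ν Ω w → EqOn w v (Ici 0)) ∧
      ∀ j : ℕ, 1 ≤ j →
        IntegrableOn (fun t : ℝ => t ^ (j - 1) * RandomWalk.heatContent m ν Ω v t) (Ioi 0) ∧
        Summable (fun k : ℕ => ((k + j - 1).choose (j - 1) : ℝ) * RandomWalk.g m ν Ω k) ∧
        RandomWalk.exitMoment (RandomWalk.heatContent m ν Ω v) j =
          (j.factorial : ℝ) *
            ∑' k : ℕ, ((k + j - 1).choose (j - 1) : ℝ) * RandomWalk.g m ν Ω k := by
  have hΩfin : ν Ω ≠ ⊤ := (hlt.trans hfin).ne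
  have hv := RandomWalk.isDirichletHeatSolution_heatFlow hrev hΩ hΩfin
  refine ⟨_, hv, fun w hw => hw.eqOn hrev hΩ hΩfin hv, fun j hj => ?_⟩
  obtain ⟨i, rfl⟩ := Nat.exists_eq_add_of_le' hj
  simp only [← add_assoc, Nat.add_sub_cancel]
  have hsum := RandomWalk.summable_choose_mul_g hrev hΩ hΩfin hpoinc i
  obtain ⟨h1, h2⟩ := RandomWalk.integral_pow_mul_poisson RandomWalk.g_nonneg
    (RandomWalk.hasSum_heatContent_heatFlow hrev hΩ hΩfin) i hsum
  refine ⟨h1, hsum, ?_⟩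
  rw [RandomWalk.exitMoment, Nat.add_sub_cancel, h2, Nat.factorial_succ]
  push_cast
  ring
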